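/- Let $D\ge 0$ and $q\ge 2$ be integers, and let $X=\{0,1,\dots,q-1\}^D$ be the vertex set of the Hamming scheme $\mathrm{H}(D,q)$, with associate matrices $A_0,\dots,A_D$ (where $(A_i)_{xy}=1$ if $x,y$ differ in exactly $i$ coordinates, and $(A_i)_{xy}=0$ otherwise) and primitive idempotents $E_0,\dots,E_D$ of its Bose–Mesner algebra in the standard ordering, that is, $E_j$ is the orthogonal projection of $\mathbb{C}^X$ onto the eigenspace of $A_1$ with eigenvalue $D(q-1)-qj$. A code is a subset $Y\subseteq X$ with $1<|Y|<|X|$. For a code $Y$ with characteristic vector $\chi\in\mathbb{C}^X$, let $$\delta(Y)=\min\{i\neq 0:\langle\chi,A_i\chi\rangle\neq 0\},\quad s(Y)=|\{i\neq 0:\langle\chi,A_i\chi\rangle\neq 0\}|,\quad \delta^*(Y)=\min\{j\neq 0:E_j\chi\neq 0\}$$ be its minimum distance, degree and dual distance. Then every code $Y$ in $\mathrm{H}(D,q)$ satisfies $$\delta^*(Y)\le \delta(Y)+s(Y)-1,$$ unless $q=2$ and $Y$ is a bipartite half of $\mathrm{H}(D,2)$ (one of the two colour classes of the bipartite graph on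 $X$ whose edges are the pairs at Hamming distance $1$). Moreover, the repetition code $Y$ of $\mathrm{H}(D,2)$ (the set of the two constant words), whenever it is a code in the above sense, satisfies $\delta^*(Y)=2$, $s(Y)=1$ and $\delta(Y)=D$. -/

import Mathlib

open scoped InnerProductSpace

noncomputable section

namespace HammingScheme

variable {D q : ℕ}

/-- The vertex set of the Hamming scheme `H(D,q)`: words of length `D` over `{0, …, q-1}`. -/
abbrev Vertex (D q : ℕ) : Type := Fin D → Fin q

/-- The standard module: complex column vectors indexed by the vertices, with the standard
Hermitian inner product. -/
abbrev StdModule (D q : ℕ) : Type := EuclideanSpace ℂ (Vertex D q)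

/-- The `i`-th associate matrix: its `(x, y)` entry is `1` if the words `x` and `y` differ in
exactly `i` coordinates, and `0` otherwise. -/
def assocMatrix (D q i : ℕ) : Matrix (Vertex D q) (Vertex D q) ℂ :=
  Matrix.of fun x y => if hammingDist x y = i then 1 else 0

/-- The action of the `i`-th associate matrix on the standard module. -/
def assocOp (D q i : ℕ) : StdModule D q →ₗ[ℂ] StdModule D q :=
  Matrix.toEuclideanLin (assocMatrix D q i)

/-- The `j`-th eigenvalue `D (q - 1) - q j` of the first associate matrix, in the standard
(decreasing, cometric) ordering. -/
def theta (D q j : ℕ) : ℂ := (D : ℂ) * ((q : ℂ) - 1) - (q : ℂ) * (j : ℂ)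

/-- The `j`-th primitive idempotent `E_j` (`0 ≤ j ≤ D`) of the Bose-Mesner algebra, acting on
the standard module. The scheme is metric, so the Bose-Mesner algebra is generated by the first
associate matrix, whose distinct eigenvalues are `theta D q 0 > ⋯ > theta D q D`; its primitive
idempotents are therefore the orthogonal projections onto the eigenspaces of that matrix. -/
def primIdem (D q j : ℕ) : StdModule D q →L[ℂ] StdModule D q :=
  (Module.End.eigenspace (assocOp D q 1) (theta D q j)).starProjection

/-- The characteristic vector of a set of vertices. -/
def charVec (Y : Finset (Vertex D q)) : StdModule D q :=
  WithLp.toLp 2 fun x => if x ∈ Y then 1 else 0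

/-- A set `Y` of vertices is a code if `1 < |Y| < |X|`. -/
def IsCode (Y : Finset (Vertex D q)) : Prop :=
  1 < Y.card ∧ Y.card < Fintype.card (Vertex D q)

/-- The indices `i ≠ 0` with `⟨χ, A_i χ⟩ ≠ 0`, where `χ` is the characteristic vector of `Y`. -/
def distanceSet (Y : Finset (Vertex D q)) : Set ℕ :=
  {i | i ≠ 0 ∧ i ≤ D ∧ ⟪charVec Y, assocOp D q i (charVec Y)⟫_ℂ ≠ 0}

/-- The indices `j ≠ 0` with `E_j χ ≠ 0`, where `χ` is the characteristic vector of `Y`. -/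
def dualDistanceSet (Y : Finset (Vertex D q)) : Set ℕ :=
  {j | j ≠ 0 ∧ j ≤ D ∧ primIdem D q j (charVec Y) ≠ 0}

/-- The minimum distance `δ` of a code. -/
def minDistance (Y : Finset (Vertex D q)) : ℕ := sInf (distanceSet Y)

/-- The degree `s` of a code. -/
def degree (Y : Finset (Vertex D q)) : ℕ := (distanceSet Y).ncard

/-- The dual distance `δ*` of a code. -/
def dualDistance (Y : Finset (Vertex D q)) : ℕ := sInf (dualDistanceSet Y)

/-- The Hamming graph: the graph of the first associate relation. -/
def graph (D q : ℕ) : SimpleGraph (Vertex D q) where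
  Adj x y := hammingDist x y = 1
  symm := ⟨fun x y h => by rw [hammingDist_comm]; exact h⟩
  loopless := ⟨fun x h => by simp at h⟩

/-- `Y` is a bipartite half of the binary scheme `H(D,2)`: the alphabet has two letters, and `Y`
and its complement form a bipartition of the Hamming graph. (That graph is connected, so its
bipartition is unique, and the halves are the words of even weight and those of odd weight.) -/
def IsBipartiteHalf (Y : Finset (Vertex D q)) : Prop :=
  q = 2 ∧ (graph D q).IsBipartiteWith (Y : Set (Vertex D q)) (Y : Set (Vertex D q))ᶜ

/-- The repetition code: the set of constant words. -/
def repetitionCode (D q : ℕ) : Finset (Vertex D q) :=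
  Finset.univ.image fun (a : Fin q) (_ : Fin D) => a

end HammingScheme

end

namespace HammingScheme

open Finset

variable {D q : ℕ}

/-! Suppose δ* ≥ δ + s. Sums of one-coordinate products with zero-sum factors lie in the
eigenspaces, so `Y` averages every function of degree at most δ + s - 1 in the coordinates exactly
as the whole space does (`sum_eq_of_mem_juntaSpan`). For `x ∈ Y` and `z` at distance δ from `x`,
take the indicator of the words agreeing with `z` where `x` and `z` differ (degree δ), times the
polynomial in the distance to `x` that vanishes at the s - 1 nonzero distances other than δ. On `Y`
this product can survive only at `z`, while its total over the space does not depend on the pair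
(`sum_dist_subcube_eq`). Some such `z` lies in `Y`, hence all do
(`mem_of_hammingDist_eq_minDistance`).

So `Y` is closed under moves of length δ, and δ < D because s ≥ 1 and δ* ≤ D. Two moves that nearly
cancel yield words of `Y` at distance 1 if q ≥ 3, or 2 if q = 2. As δ = 1 would make `Y` everything
by connectivity, only q = 2, δ = 2 remains, and closure then gives a bipartite half
(`isBipartiteHalf_of_closed`). -/

lemma assocOp_apply (i : ℕ) (v : StdModule D q) (x : Vertex D q) :
    assocOp D q i v x = ∑ y, if hammingDist x y = i then v y else 0 := by
  simp [assocOp, assocMatrix, Matrix.toLpLin_apply, Matrix.mulVec, dotProduct]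

lemma inner_charVec (Y : Finset (Vertex D q)) (v : StdModule D q) :
    ⟪charVec Y, v⟫_ℂ = ∑ y ∈ Y, v y := by
  simp [charVec, PiLp.inner_apply, Finset.sum_ite_mem, apply_ite]

lemma inner_charVec_assocOp_ne_zero_iff (Y : Finset (Vertex D q)) (i : ℕ) :
    ⟪charVec Y, assocOp D q i (charVec Y)⟫_ℂ ≠ 0 ↔ ∃ x ∈ Y, ∃ y ∈ Y, hammingDist x y = i := by
  have h : ⟪charVec Y, assocOp D q i (charVec Y)⟫_ℂ
      = ((∑ x ∈ Y, ∑ y ∈ Y, if hammingDist x y = i then 1 else 0 : ℕ) : ℂ) := by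
    rw [inner_charVec]
    push_cast
    refine Finset.sum_congr rfl fun x _ => ?_
    rw [assocOp_apply, ← Finset.sum_filter_add_sum_filter_not univ (· ∈ Y)]
    simp only [charVec]
    rw [Finset.sum_eq_zero (s := univ.filter (· ∉ Y)) (by intro y hy; simp_all)]
    rw [add_zero]
    simp only [Finset.filter_mem_eq_inter, Finset.univ_inter]
    exact Finset.sum_congr rfl fun y hy => by simp [hy]
  rw [h, Ne, Nat.cast_eq_zero, Finset.sum_eq_zero_iff]
  simp only [Finset.sum_eq_zero_iff]
  push Not
  simp

lemma mem_distanceSet {Y : Finset (Vertex D q)} {i : ℕ} :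
    i ∈ distanceSet Y ↔ i ≠ 0 ∧ ∃ x ∈ Y, ∃ y ∈ Y, hammingDist x y = i := by
  simp only [distanceSet, Set.mem_ofPred_eq, inner_charVec_assocOp_ne_zero_iff]
  constructor
  · rintro ⟨h, -, h'⟩; exact ⟨h, h'⟩
  · rintro ⟨h, x, hx, y, hy, rfl⟩
    exact ⟨h, by simpa using hammingDist_le_card_fintype (x := x) (y := y), x, hx, y, hy, rfl⟩

lemma finite_distanceSet (Y : Finset (Vertex D q)) : (distanceSet Y).Finite :=
  (Set.finite_Iic D).subset fun _ h => h.2.1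

lemma distanceSet_nonempty {Y : Finset (Vertex D q)} (hY : 1 < Y.card) :
    (distanceSet Y).Nonempty := by
  obtain ⟨x, hx, y, hy, hxy⟩ := Finset.one_lt_card.1 hY
  exact ⟨_, mem_distanceSet.2 ⟨hammingDist_ne_zero.2 hxy, x, hx, y, hy, rfl⟩⟩

/-! ### Explicit eigenvectors of the Hamming graph. -/

lemma hammingDist_update_eq_one (y : Vertex D q) {i : Fin D} {b : Fin q} (hb : b ≠ y i) :
    hammingDist y (Function.update y i b) = 1 := by
  rw [hammingDist, Finset.card_eq_one]
  refine ⟨i, ?_⟩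
  ext j
  by_cases h : j = i
  · subst h; simp [hb.symm]
  · simp [h]

lemma exists_update_of_hammingDist_eq_one {y z : Vertex D q} (h : hammingDist y z = 1) :
    ∃ i, z i ≠ y i ∧ z = Function.update y i (z i) := by
  obtain ⟨i, hi⟩ := Finset.card_eq_one.1 h
  have hi' : ∀ j, y j ≠ z j ↔ j = i := fun j => by
    simpa using (Finset.ext_iff.1 hi) j
  refine ⟨i, ((hi' i).2 rfl).symm, ?_⟩
  ext j
  by_cases hj : j = i
  · subst hj; simp
  · have : y j = z j := by by_contra h'; exact hj ((hi' j).1 h')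
    simp [hj, this]

/-- A sum over the neighbours of a word is a sum over the changes of one coordinate. -/
lemma sum_neighbours (F : Vertex D q → ℂ) (y : Vertex D q) :
    (∑ z, if hammingDist y z = 1 then F z else 0)
      = ∑ i, ∑ b ∈ univ.erase (y i), F (Function.update y i b) := by
  rw [← Finset.sum_filter, Finset.sum_sigma']
  symm
  refine Finset.sum_bij (fun p _ => Function.update y p.1 p.2) ?_ ?_ ?_ ?_
  · rintro ⟨i, b⟩ h
    simp only [mem_sigma, mem_univ, mem_erase, true_and, and_true] at h
    simpa using hammingDist_update_eq_one y h
  · rintro ⟨i, b⟩ h ⟨j, c⟩ h' e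
    simp only [mem_sigma, mem_univ, mem_erase, true_and, and_true] at h h' e
    have hij : i = j := by
      by_contra hne
      have := congrFun e i
      simp [hne] at this
      exact h this
    subst hij
    have := congrFun e i
    simp at this
    simp [this]
  · intro z hz
    obtain ⟨i, h1, h2⟩ := exists_update_of_hammingDist_eq_one (by simpa using hz)
    exact ⟨⟨i, z i⟩, by simpa using h1, h2.symm⟩
  · intros; rfl

/-- The product of functions of the coordinates in `S`. -/
def coordProd (S : Finset (Fin D)) (φ : Fin D → Fin q → ℂ) : Vertex D q → ℂ :=
  fun y => ∏ i ∈ S, φ i (y i)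

lemma coordProd_update_of_notMem {S : Finset (Fin D)} (φ : Fin D → Fin q → ℂ) (y : Vertex D q)
    {i : Fin D} (hi : i ∉ S) (b : Fin q) :
    coordProd S φ (Function.update y i b) = coordProd S φ y :=
  Finset.prod_congr rfl fun j hj => by
    rw [Function.update_of_ne (ne_of_mem_of_not_mem hj hi)]

lemma coordProd_update_of_mem {S : Finset (Fin D)} (φ : Fin D → Fin q → ℂ) (y : Vertex D q)
    {i : Fin D} (hi : i ∈ S) (b : Fin q) :
    coordProd S φ (Function.update y i b) = φ i b * coordProd (S.erase i) φ y := by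
  conv_lhs => rw [coordProd, ← Finset.mul_prod_erase S _ hi]
  rw [Function.update_self]
  congr 1
  exact coordProd_update_of_notMem φ y (Finset.notMem_erase i S) b

/-- A product of zero-sum functions of the coordinates in `S` is an eigenvector of the first
associate matrix. -/
lemma coordProd_mem_eigenspace (S : Finset (Fin D)) (φ : Fin D → Fin q → ℂ)
    (hφ : ∀ i ∈ S, ∑ a, φ i a = 0) :
    WithLp.toLp 2 (coordProd S φ) ∈ Module.End.eigenspace (assocOp D q 1) (theta D q S.card) := by
  rw [Module.End.mem_eigenspace_iff]
  ext y
  rw [assocOp_apply]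
  simp only [PiLp.smul_apply, smul_eq_mul]
  rw [sum_neighbours]
  -- A direction in `S` contributes -1 by the zero sum, a direction outside contributes q - 1; with
  -- `S.card = j` the total is D(q - 1) - qj.
  have h1 : ∀ i ∈ S, ∑ b ∈ univ.erase (y i), coordProd S φ (Function.update y i b)
      = - coordProd S φ y := by
    intro i hi
    simp_rw [coordProd_update_of_mem φ y hi]
    rw [← Finset.sum_mul]
    have h := Finset.add_sum_erase univ (φ i) (mem_univ (y i))
    rw [hφ i hi] at h
    rw [eq_neg_of_add_eq_zero_right h, coordProd, coordProd,
      ← Finset.mul_prod_erase S (fun i => φ i (y i)) hi]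
    ring
  have h2 : ∀ i ∈ Sᶜ, ∑ b ∈ univ.erase (y i), coordProd S φ (Function.update y i b)
      = ((q : ℂ) - 1) * coordProd S φ y := by
    intro i hi
    simp_rw [coordProd_update_of_notMem φ y (Finset.mem_compl.1 hi)]
    have : 1 ≤ q := Nat.one_le_iff_ne_zero.2 fun h => by subst h; exact (y i).elim0
    simp [Finset.card_erase_of_mem, Nat.cast_sub this]
  rw [← Finset.sum_add_sum_compl S, Finset.sum_congr rfl h1, Finset.sum_congr rfl h2]
  have : S.card ≤ D := by simpa using S.card_le_univ
  simp only [sum_neg_distrib, sum_const, nsmul_eq_mul, card_compl, Fintype.card_fin, theta,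
    Nat.cast_sub this]
  ring

lemma assocOp_isSymmetric (i : ℕ) : (assocOp D q i).IsSymmetric := by
  rw [assocOp, Matrix.isSymmetric_toEuclideanLin_iff]
  ext x y
  simp [assocMatrix, hammingDist_comm, apply_ite]

lemma theta_injective (hq : q ≠ 0) : Function.Injective (theta D q) := by
  intro i j h
  have hq' : (q : ℂ) ≠ 0 := by exact_mod_cast hq
  simp only [theta, sub_right_inj] at h
  exact_mod_cast mul_left_cancel₀ hq' h

lemma inner_eq_zero_of_mem_eigenspace (hq : q ≠ 0) {i j : ℕ} (hij : i ≠ j) {v w : StdModule D q}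
    (hv : v ∈ Module.End.eigenspace (assocOp D q 1) (theta D q i))
    (hw : w ∈ Module.End.eigenspace (assocOp D q 1) (theta D q j)) : ⟪v, w⟫_ℂ = 0 :=
  (assocOp_isSymmetric (D := D) (q := q) 1).orthogonalFamily_eigenspaces
    ((theta_injective hq).ne hij) ⟨v, hv⟩ ⟨w, hw⟩

lemma primIdem_eq_zero_iff (j : ℕ) (v : StdModule D q) :
    primIdem D q j v = 0 ↔
      ∀ w ∈ Module.End.eigenspace (assocOp D q 1) (theta D q j), ⟪v, w⟫_ℂ = 0 := by
  rw [primIdem, Submodule.starProjection_apply_eq_zero_iff, Submodule.mem_orthogonal']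

/-- Orthogonality to the constant function, which is the empty product with eigenvalue index 0. -/
lemma sum_coordProd_eq_zero (hq : q ≠ 0) {S : Finset (Fin D)} (hS : S.Nonempty)
    (φ : Fin D → Fin q → ℂ) (hφ : ∀ i ∈ S, ∑ a, φ i a = 0) : ∑ y, coordProd S φ y = 0 := by
  have h := inner_eq_zero_of_mem_eigenspace hq (Finset.card_pos.2 hS).ne
    (coordProd_mem_eigenspace (∅ : Finset (Fin D)) φ (by simp)) (coordProd_mem_eigenspace S φ hφ)
  simpa [PiLp.inner_apply, coordProd] using h

/-! ### Low-degree functions and designs. -/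

/-- The span of the functions depending on at most `k` coordinates. -/
def juntaSpan (D q k : ℕ) : Submodule ℂ (Vertex D q → ℂ) :=
  Submodule.span ℂ {F | ∃ S : Finset (Fin D), S.card ≤ k ∧ ∃ φ, F = coordProd S φ}

lemma coordProd_mem_juntaSpan {S : Finset (Fin D)} {k : ℕ} (hS : S.card ≤ k)
    (φ : Fin D → Fin q → ℂ) : coordProd S φ ∈ juntaSpan D q k :=
  Submodule.subset_span ⟨S, hS, φ, rfl⟩

lemma juntaSpan_mono {k l : ℕ} (h : k ≤ l) : juntaSpan D q k ≤ juntaSpan D q l :=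
  Submodule.span_mono fun _ ⟨S, hS, hF⟩ => ⟨S, hS.trans h, hF⟩

lemma coord_mul_mem_juntaSpan {k : ℕ} {F : Vertex D q → ℂ} (hF : F ∈ juntaSpan D q k)
    (i : Fin D) (ψ : Fin q → ℂ) : (fun y => ψ (y i) * F y) ∈ juntaSpan D q (k + 1) := by
  let M : (Vertex D q → ℂ) →ₗ[ℂ] (Vertex D q → ℂ) := LinearMap.mulLeft ℂ fun y => ψ (y i)
  suffices h : juntaSpan D q k ≤ (juntaSpan D q (k + 1)).comap M from h hF
  refine Submodule.span_le.2 ?_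
  rintro _ ⟨S, hS, φ, rfl⟩
  by_cases hi : i ∈ S
  · have : M (coordProd S φ)
        = coordProd S (Function.update φ i fun a => ψ a * φ i a) := by
      ext y
      simp only [M, LinearMap.mulLeft_apply, Pi.mul_apply, coordProd]
      rw [← Finset.mul_prod_erase S _ hi, ← Finset.mul_prod_erase S _ hi, Function.update_self,
        mul_assoc]
      congr 2
      exact Finset.prod_congr rfl fun j hj => by
        rw [Function.update_of_ne (Finset.ne_of_mem_erase hj)]
    simp only [Submodule.comap_coe, Set.mem_preimage, SetLike.mem_coe, this]
    exact coordProd_mem_juntaSpan (by omega) _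
  · have : M (coordProd S φ) = coordProd (insert i S) (Function.update φ i ψ) := by
      ext y
      simp only [M, LinearMap.mulLeft_apply, Pi.mul_apply, coordProd]
      rw [Finset.prod_insert hi, Function.update_self]
      congr 1
      exact Finset.prod_congr rfl fun j hj => by
        rw [Function.update_of_ne (ne_of_mem_of_not_mem hj hi)]
    simp only [Submodule.comap_coe, Set.mem_preimage, SetLike.mem_coe, this]
    exact coordProd_mem_juntaSpan (by rw [Finset.card_insert_of_notMem hi]; omega) _

/-- The distance to a fixed word is a sum of functions of single coordinates, so it has degree one.
-/
lemma dist_sub_mul_mem_juntaSpan {k : ℕ} {F : Vertex D q → ℂ} (hF : F ∈ juntaSpan D q k)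
    (x : Vertex D q) (c : ℂ) :
    (fun y => ((hammingDist x y : ℂ) - c) * F y) ∈ juntaSpan D q (k + 1) := by
  have h : (fun y => ((hammingDist x y : ℂ) - c) * F y)
      = (∑ i, fun y => (if x i ≠ y i then (1 : ℂ) else 0) * F y) - c • F := by
    ext y
    simp only [Pi.sub_apply, Finset.sum_apply, Pi.smul_apply, smul_eq_mul]
    rw [← Finset.sum_mul, sub_mul, hammingDist, Finset.card_filter]
    push_cast
    rfl
  rw [h]
  exact Submodule.sub_mem _
    (Submodule.sum_mem _ fun i _ =>
      coord_mul_mem_juntaSpan hF i fun a => if x i ≠ a then 1 else 0)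
    (Submodule.smul_mem _ _ (juntaSpan_mono (Nat.le_succ k) hF))

lemma prod_dist_sub_mul_mem_juntaSpan {k : ℕ} {F : Vertex D q → ℂ} (hF : F ∈ juntaSpan D q k)
    (x : Vertex D q) (M : Finset ℕ) :
    (fun y => (∏ m ∈ M, ((hammingDist x y : ℂ) - m)) * F y) ∈ juntaSpan D q (k + M.card) := by
  induction M using Finset.induction_on with
  | empty => simpa using hF
  | insert m M hm ih =>
    simp_rw [Finset.prod_insert hm, Finset.card_insert_of_notMem hm, mul_assoc]
    exact dist_sub_mul_mem_juntaSpan ih x m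

/-- If the dual distance of `Y` exceeds `t`, then `Y` is a design of strength `t`. -/
lemma sum_eq_of_mem_juntaSpan (hq : q ≠ 0) {Y : Finset (Vertex D q)} {t : ℕ}
    (ht : t < dualDistance Y) {F : Vertex D q → ℂ} (hF : F ∈ juntaSpan D q t) :
    ∑ y ∈ Y, F y = (Y.card / (q : ℂ) ^ D) * ∑ y, F y := by
  -- The infimum of the empty set is 0, so `ht` forces the dual distance to be attained.
  have hD : dualDistance Y ≤ D :=
    (Nat.sInf_mem (s := dualDistanceSet Y) (Nat.nonempty_of_pos_sInf (Nat.zero_lt_of_lt ht))).2.1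
  have hE : ∀ j, j ≠ 0 → j ≤ t → primIdem D q j (charVec Y) = 0 := by
    intro j hj hjt
    by_contra h
    exact Nat.notMem_of_lt_sInf (hjt.trans_lt ht) ⟨hj, by omega, h⟩
  let L : (Vertex D q → ℂ) →ₗ[ℂ] ℂ :=
    ∑ y ∈ Y, LinearMap.proj y - (Y.card / (q : ℂ) ^ D) • ∑ y, LinearMap.proj y
  have hL : ∀ F, L F = ∑ y ∈ Y, F y - (Y.card / (q : ℂ) ^ D) * ∑ y, F y := by
    intro F; simp [L]
  rw [← sub_eq_zero, ← hL]
  suffices h : juntaSpan D q t ≤ LinearMap.ker L from h hF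
  refine Submodule.span_le.2 ?_
  rintro _ ⟨S, hS, φ, rfl⟩
  have hq' : (q : ℂ) ≠ 0 := by exact_mod_cast hq
  have zero : ∀ T : Finset (Fin D), T.card ≤ t → ∀ ψ : Fin D → Fin q → ℂ,
      (∀ i ∈ T, ∑ a, ψ i a = 0) → L (coordProd T ψ) = 0 := by
    intro T hT ψ hψ
    rw [hL]
    rcases T.eq_empty_or_nonempty with rfl | hne
    · simp [coordProd, hq']
    · rw [sum_coordProd_eq_zero hq hne ψ hψ, mul_zero, sub_zero]
      have := (primIdem_eq_zero_iff _ _).1 (hE T.card (Finset.card_pos.2 hne).ne' hT) _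
        (coordProd_mem_eigenspace T ψ hψ)
      rwa [inner_charVec] at this
  -- Splitting each factor into its mean and a zero-sum part and expanding the product reduces the
  -- claim to zero-sum products.
  let μ : Fin D → ℂ := fun i => (∑ a, φ i a) / q
  have hexp : coordProd S φ
      = ∑ T ∈ S.powerset, (∏ i ∈ S \ T, μ i) • coordProd T fun i a => φ i a - μ i := by
    ext y
    simp only [Finset.sum_apply, Pi.smul_apply, smul_eq_mul]
    have := Finset.prod_add (fun i => φ i (y i) - μ i) μ S
    simp only [sub_add_cancel] at this
    rw [coordProd, this]
    exact Finset.sum_congr rfl fun T _ => by rw [coordProd, mul_comm]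
  rw [SetLike.mem_coe, LinearMap.mem_ker, hexp, map_sum]
  refine Finset.sum_eq_zero fun T hT => ?_
  rw [map_smul, zero T ((Finset.card_le_card (Finset.mem_powerset.1 hT)).trans hS), smul_zero]
  intro i _
  simp only [μ, Finset.sum_sub_distrib, Finset.sum_const, Finset.card_univ, Fintype.card_fin,
    nsmul_eq_mul]
  field_simp
  ring

/-! ### Symmetry, and closure under distance δ. -/

lemma exists_perm_map_pair {α : Type*} [DecidableEq α] {a b a' b' : α} (h : a ≠ b) (h' : a' ≠ b') :
    ∃ σ : Equiv.Perm α, σ a = a' ∧ σ b = b' := by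
  refine ⟨(Equiv.swap a a').trans (Equiv.swap (Equiv.swap a a' b) b'), ?_, by simp⟩
  have h1 : a' ≠ Equiv.swap a a' b := fun e =>
    h ((Equiv.swap a a').injective ((Equiv.swap_apply_left a a').trans e))
  simp [Equiv.swap_apply_of_ne_of_ne h1 h']

/-- The automorphism group of the Hamming scheme acts transitively on the pairs consisting of a
word and a subcube of fixed codimension disagreeing with the word on every fixed coordinate. -/
lemma sum_dist_subcube_eq {S S' : Finset (Fin D)} (hS : S.card = S'.card) {x x' c c' : Vertex D q}
    (hc : ∀ i ∈ S, x i ≠ c i) (hc' : ∀ i ∈ S', x' i ≠ c' i) (G : ℕ → ℂ) :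
    (∑ y, G (hammingDist x y) * if ∀ i ∈ S, y i = c i then 1 else 0)
      = ∑ y, G (hammingDist x' y) * if ∀ i ∈ S', y i = c' i then 1 else 0 := by
  -- The automorphism permutes positions so that `S'` goes to `S`, then relabels the letters
  -- position by position.
  let π : Equiv.Perm (Fin D) := (Finset.equivOfCardEq hS.symm).extendSubtype
  have hπ : ∀ k, π k ∈ S ↔ k ∈ S' := fun k =>
    ⟨fun h => by_contra fun hk => Equiv.extendSubtype_not_mem _ k hk h,
      fun h => Equiv.extendSubtype_mem _ k h⟩
  have hσ : ∀ k, ∃ σ : Equiv.Perm (Fin q), σ (x (π k)) = x' k ∧ (k ∈ S' → σ (c (π k)) = c' k) := by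
    intro k
    by_cases hk : k ∈ S'
    · obtain ⟨σ, h1, h2⟩ := exists_perm_map_pair (hc (π k) ((hπ k).2 hk)) (hc' k hk)
      exact ⟨σ, h1, fun _ => h2⟩
    · exact ⟨Equiv.swap (x (π k)) (x' k), by simp, fun h => absurd h hk⟩
  choose σ hσx hσc using hσ
  let e : Vertex D q ≃ Vertex D q :=
    (Equiv.arrowCongr π.symm (Equiv.refl (Fin q))).trans (Equiv.piCongrRight σ)
  have he : ∀ y k, e y k = σ k (y (π k)) := fun y k => by simp [e]
  refine Fintype.sum_equiv e _ _ fun y => ?_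
  have h1 : hammingDist x' (e y) = hammingDist x y := by
    simp only [hammingDist]
    refine Finset.card_bij (fun k _ => π k) ?_ (fun _ _ _ _ h => π.injective h) ?_
    · intro k hk
      simp only [mem_filter, mem_univ, true_and, he] at hk ⊢
      rw [← hσx k] at hk
      exact fun h => hk (congrArg _ h)
    · intro k hk
      refine ⟨π.symm k, ?_, by simp⟩
      simp only [mem_filter, mem_univ, true_and, he] at hk ⊢
      rw [← hσx, Equiv.apply_symm_apply, Ne, (σ _).injective.eq_iff]
      exact hk
  have h2 : (∀ i ∈ S, y i = c i) ↔ ∀ i ∈ S', e y i = c' i := by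
    constructor
    · intro h i hi
      rw [he, h _ ((hπ i).2 hi), hσc i hi]
    · intro h i hi
      have hi' : π.symm i ∈ S' := (hπ _).1 (by simpa using hi)
      have := h _ hi'
      rw [he, ← hσc _ hi', (σ _).injective.eq_iff] at this
      simpa using this
  rw [h1]
  simp only [h2]

/-- If the dual distance is at least `δ + s`, then the code contains every word at distance `δ`
from one of its words. -/
lemma mem_of_hammingDist_eq_minDistance (hq : q ≠ 0) {Y : Finset (Vertex D q)} (hY : 1 < Y.card)
    (h : minDistance Y + degree Y ≤ dualDistance Y) {x z : Vertex D q} (hx : x ∈ Y)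
    (hz : hammingDist x z = minDistance Y) : z ∈ Y := by
  have hmin : minDistance Y ∈ distanceSet Y := Nat.sInf_mem (distanceSet_nonempty hY)
  obtain ⟨hδ, x₀, hx₀, z₀, hz₀, hxz₀⟩ := mem_distanceSet.1 hmin
  set M : Finset ℕ := (finite_distanceSet Y).toFinset.erase (minDistance Y) with hM
  have hMcard : M.card + 1 = degree Y := by
    rw [hM, Finset.card_erase_add_one (by simpa using hmin), degree,
      Set.ncard_eq_toFinset_card _ (finite_distanceSet Y)]
  let P : ℕ → ℂ := fun n => ∏ m ∈ M, ((n : ℂ) - m)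
  have hP : P (minDistance Y) ≠ 0 := by
    refine Finset.prod_ne_zero_iff.2 fun m hm => sub_ne_zero.2 ?_
    exact_mod_cast (Finset.ne_of_mem_erase hm).symm
  have key : ∀ u ∈ Y, ∀ c : Vertex D q, hammingDist u c = minDistance Y →
      P (minDistance Y) * (if c ∈ Y then 1 else 0) = (Y.card / (q : ℂ) ^ D) *
        ∑ y, P (hammingDist u y) * if ∀ i ∈ univ.filter (fun i => u i ≠ c i), y i = c i
          then 1 else 0 := by
    intro u hu c huc
    set S := univ.filter fun i => u i ≠ c i with hSdef
    have hS : S.card = minDistance Y := huc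
    have hF : ∀ y, coordProd S (fun i a => if a = c i then 1 else 0) y
        = if ∀ i ∈ S, y i = c i then 1 else 0 := fun y => by
      simp only [coordProd]
      simp [Finset.prod_boole]
    have h1 := sum_eq_of_mem_juntaSpan hq (Y := Y) (t := minDistance Y + M.card) (by omega)
      (prod_dist_sub_mul_mem_juntaSpan
        (coordProd_mem_juntaSpan hS.le fun i a => if a = c i then 1 else 0) u M)
    simp only [hF] at h1
    rw [← h1]
    have h2 : ∀ y ∈ Y, (∏ m ∈ M, ((hammingDist u y : ℂ) - m)) *
        (if ∀ i ∈ S, y i = c i then 1 else 0) = if y = c then P (minDistance Y) else 0 := by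
      intro y hy
      by_cases hyc : y = c
      · subst hyc
        simp [P, huc]
      rw [if_neg hyc]
      by_cases hag : ∀ i ∈ S, y i = c i
      · have hne : hammingDist u y ≠ 0 := by
          rw [hammingDist_ne_zero]
          rintro rfl
          obtain ⟨i, hi⟩ := Finset.card_pos.1 (by omega : 0 < S.card)
          exact (Finset.mem_filter.1 hi).2 (hag i hi)
        -- A word at distance δ from `u` agreeing with `c` on `S` already differs from `u` on all of
        -- `S`, hence nowhere else, and so equals `c`.
        have hmem : hammingDist u y ∈ M := by
          refine Finset.mem_erase.2 ⟨fun hd => hyc ?_, by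
            simpa using mem_distanceSet.2 ⟨hne, u, hu, y, hy, rfl⟩⟩
          have hsub : S ⊆ univ.filter fun i => u i ≠ y i := fun i hi => by
            have := (Finset.mem_filter.1 hi).2
            simpa [hag i hi] using this
          have heq := Finset.eq_of_subset_of_card_le hsub (by rw [hS]; exact hd.le)
          ext i
          by_cases hi : i ∈ S
          · rw [hag i hi]
          · have h3 : u i = c i := by simpa [hSdef] using hi
            have h4 : u i = y i := by rw [heq] at hi; simpa using hi
            rw [← h4, h3]
        rw [Finset.prod_eq_zero hmem (sub_self _), zero_mul]
      · rw [if_neg hag, mul_zero]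
    rw [Finset.sum_congr rfl h2, Finset.sum_ite_eq']
    simp
  have k₀ := key x₀ hx₀ z₀ hxz₀
  have k₁ := key x hx z hz
  rw [sum_dist_subcube_eq (S' := univ.filter fun i => x i ≠ z i) (x' := x) (c' := z)
    (hxz₀.trans hz.symm) (fun i hi => (Finset.mem_filter.1 hi).2)
    (fun i hi => (Finset.mem_filter.1 hi).2) P, ← k₁, if_pos hz₀] at k₀
  by_contra hzY
  simp [hzY, hP] at k₀

/-! ### Codes closed under distance δ. -/

/-- Connectivity of the Hamming graph: coordinates of `x` are replaced by those of `z` one at a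
time. -/
lemma eq_univ_of_closed {C : Set (Vertex D q)} (hC : C.Nonempty)
    (h : ∀ x ∈ C, ∀ z, hammingDist x z = 1 → z ∈ C) : ∀ z, z ∈ C := by
  obtain ⟨x, hx⟩ := hC
  intro z
  suffices H : ∀ T : Finset (Fin D), (fun i => if i ∈ T then z i else x i) ∈ C by
    simpa using H univ
  intro T
  induction T using Finset.induction_on with
  | empty => simpa using hx
  | insert i T hi ih =>
    have e : (fun j => if j ∈ insert i T then z j else x j)
        = Function.update (fun j => if j ∈ T then z j else x j) i (z i) := by
      ext j
      by_cases hj : j = i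
      · subst hj; simp
      · simp [hj]
    rw [e]
    by_cases hzx : z i = x i
    · have : (if i ∈ T then z i else x i) = z i := by simp [hzx]
      rw [← this, Function.update_eq_self (f := fun j => if j ∈ T then z j else x j)]
      exact ih
    · exact h _ ih _ (hammingDist_update_eq_one _ (by simpa [hi] using hzx))

lemma hammingDist_update_of_ne (x y : Vertex D q) {i : Fin D} {b : Fin q} (h : x i ≠ y i)
    (hb : x i ≠ b) : hammingDist x (Function.update y i b) = hammingDist x y := by
  simp only [hammingDist]
  congr 1
  ext j
  by_cases hj : j = i
  · subst hj; simp [h, hb]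
  · simp [hj]

/-- The binary Hamming graph has no triangles. -/
lemma hammingDist_two_ne_one {u v w : Vertex D 2} (h : hammingDist u v = 1)
    (h' : hammingDist v w = 1) : hammingDist u w ≠ 1 := by
  intro h''
  have aux : ∀ {a b : Vertex D 2}, hammingDist a b = 1 → ∃ i, ∀ k, a k ≠ b k ↔ k = i := by
    intro a b hab
    obtain ⟨i, hi⟩ := Finset.card_eq_one.1 hab
    exact ⟨i, fun k => by simpa using (Finset.ext_iff.1 hi) k⟩
  obtain ⟨i, hi⟩ := aux h
  obtain ⟨j, hj⟩ := aux h'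
  obtain ⟨l, hl⟩ := aux h''
  by_cases hij : i = j
  · subst hij
    have h1 := (hi i).2 rfl
    have h2 := (hj i).2 rfl
    have hil : l ≠ i := fun e => (hl i).2 e.symm (by omega)
    exact (hl l).2 rfl
      ((not_not.1 (mt (hi l).1 hil)).trans (not_not.1 (mt (hj l).1 hil)))
  · have h1 : v i = w i := not_not.1 (mt (hj i).1 hij)
    have h2 : u j = v j := not_not.1 (mt (hi j).1 (Ne.symm hij))
    exact hij (((hl i).1 (h1 ▸ (hi i).2 rfl)).trans ((hl j).1 (h2 ▸ (hj j).2 rfl)).symm)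

/-- A code containing, with each of its words, all words at distance `δ` from it, where
`0 < δ < D`, is a bipartite half of `H(D,2)`. -/
lemma isBipartiteHalf_of_closed (hq : 2 ≤ q) {Y : Finset (Vertex D q)} (hY : IsCode Y)
    (hcl : ∀ x ∈ Y, ∀ z, hammingDist x z = minDistance Y → z ∈ Y)
    (hD : minDistance Y < D) : IsBipartiteHalf Y := by
  have hmin : minDistance Y ∈ distanceSet Y := Nat.sInf_mem (distanceSet_nonempty hY.1)
  obtain ⟨hδ, x, hx, x', hx', hxx⟩ := mem_distanceSet.1 hmin
  have hle : ∀ u ∈ Y, ∀ v ∈ Y, u ≠ v → minDistance Y ≤ hammingDist u v := fun u hu v hv huv =>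
    Nat.sInf_le (mem_distanceSet.2 ⟨hammingDist_ne_zero.2 huv, u, hu, v, hv, rfl⟩)
  have hne : minDistance Y ≠ 1 := by
    intro h1
    rw [h1] at hcl
    have := eq_univ_of_closed (C := (Y : Set (Vertex D q))) ⟨x, hx⟩ hcl
    have hu : Y = univ := Finset.eq_univ_iff_forall.2 this
    have := hY.2
    rw [hu, Finset.card_univ] at this
    exact lt_irrefl _ this
  obtain ⟨i, hi⟩ : ∃ i, x i ≠ x' i := by
    obtain ⟨i, hi⟩ := Finset.card_pos.1 (by
      change 0 < hammingDist x x'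
      omega : 0 < (univ.filter fun i => x i ≠ x' i).card)
    exact ⟨i, by simpa using hi⟩
  by_cases hq3 : 3 ≤ q
  · exfalso
    obtain ⟨b, hb⟩ := Finset.exists_mem_notMem_of_card_lt_card
      (s := ({x i, x' i} : Finset (Fin q))) (t := univ)
      -- A third letter `b` at position `i` changes `x'` in one place without changing its distance
      -- to `x`.
      (by rw [Finset.card_univ, Fintype.card_fin]; exact Finset.card_le_two.trans_lt hq3)
    have hbx : b ≠ x i ∧ b ≠ x' i := by simpa using hb
    have hz := hcl x hx (Function.update x' i b)
      ((hammingDist_update_of_ne x x' hi hbx.1.symm).trans hxx)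
    have h1 := hammingDist_update_eq_one x' hbx.2
    have := hle x' hx' _ hz (hammingDist_ne_zero.1 (by omega))
    omega
  obtain rfl : q = 2 := by omega
  have h2 : minDistance Y = 2 := by
    -- Since δ < D, one of the differing positions can be traded for the agreeing position `j`; the
    -- new word is at distance δ from `x` and 2 from `x'`.
    obtain ⟨j, hj⟩ : ∃ j, x j = x' j := by
      by_contra! hall
      have : hammingDist x x' = D := by simp [hammingDist, hall]
      omega
    have hij : i ≠ j := by rintro rfl; exact hi hj
    obtain ⟨b, hb⟩ := exists_ne (x j)
    set z := Function.update (Function.update x' i (x i)) j b with hzdef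
    have hz : z ∈ Y := by
      refine hcl x hx z ?_
      rw [← hxx]
      simp only [hammingDist]
      have : (univ.filter fun k => x k ≠ z k)
          = insert j ((univ.filter fun k => x k ≠ x' k).erase i) := by
        ext k
        by_cases hkj : k = j
        · subst hkj; simp [hzdef, hb.symm]
        · by_cases hki : k = i
          · subst hki; simp [hzdef, hij]
          · simp [hzdef, hkj, hki]
      rw [this, Finset.card_insert_of_notMem (by simp [hj]),
        Finset.card_erase_add_one (by simpa using hi)]
    have hd : hammingDist x' z = 2 := by
      have : (univ.filter fun k => x' k ≠ z k) = {i, j} := by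
        ext k
        by_cases hkj : k = j
        · subst hkj; simp [hzdef, hj ▸ hb.symm]
        · by_cases hki : k = i
          · subst hki; simp [hzdef, hij, hi.symm]
          · simp [hzdef, hkj, hki]
      rw [hammingDist, this, Finset.card_pair hij]
    have := hle x' hx' z hz (hammingDist_ne_zero.1 (by omega))
    omega
  rw [h2] at hcl
  have htwo : ∀ {u v w : Vertex D 2}, u ∈ Y → hammingDist u v = 1 → hammingDist v w = 1 → w ∈ Y := by
    intro u v w hu huv hvw
    have h3 := hammingDist_two_ne_one huv hvw
    have h4 := hammingDist_triangle u v w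
    rcases Nat.eq_zero_or_pos (hammingDist u w) with h0 | h0
    · rwa [← hammingDist_eq_zero.1 h0]
    · exact hcl u hu w (by omega)
  -- `Y` together with its neighbours is closed under adjacency, so every word outside `Y` has a
  -- neighbour in `Y`.
  have hall := eq_univ_of_closed (C := {v | v ∈ Y ∨ ∃ u ∈ Y, hammingDist u v = 1})
    ⟨x, Or.inl hx⟩ (by
      rintro v (hv | ⟨u, hu, huv⟩) w hvw
      · exact Or.inr ⟨v, hv, hvw⟩
      · exact Or.inl (htwo hu huv hvw))
  refine ⟨rfl, disjoint_compl_right, fun v w hvw => ?_⟩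
  change hammingDist v w = 1 at hvw
  by_cases hv : v ∈ Y
  · refine Or.inl ⟨hv, fun hw => ?_⟩
    have := hle v hv w hw (hammingDist_ne_zero.1 (by omega))
    omega
  · refine Or.inr ⟨hv, ?_⟩
    obtain ⟨u, hu, huv⟩ := (hall v).resolve_left hv
    exact htwo hu huv hvw

lemma dualDistance_le (Y : Finset (Vertex D q)) : dualDistance Y ≤ D := by
  rcases (dualDistanceSet Y).eq_empty_or_nonempty with h | h
  · simp [dualDistance, h]
  · exact (Nat.sInf_mem h).2.1

theorem dualDistance_lt (hq : 2 ≤ q) {Y : Finset (Vertex D q)} (hY : IsCode Y)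
    (hbip : ¬ IsBipartiteHalf Y) : dualDistance Y < minDistance Y + degree Y := by
  have hdeg : 0 < degree Y :=
    (Set.ncard_pos (finite_distanceSet Y)).2 (distanceSet_nonempty hY.1)
  by_contra! h
  have hle := dualDistance_le Y
  exact hbip (isBipartiteHalf_of_closed hq hY
    (fun x hx z hz => mem_of_hammingDist_eq_minDistance (by omega) hY.1 h hx hz)
    (by omega))

/-! ### The binary repetition code. -/

lemma mem_repetitionCode {y : Vertex D q} : y ∈ repetitionCode D q ↔ ∃ a, (fun _ => a) = y := by
  simp [repetitionCode]

lemma two_le_of_isCode_repetitionCode (h : IsCode (repetitionCode D 2)) : 2 ≤ D := by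
  have h1 : (repetitionCode D 2).card < 2 ^ D := by simpa using h.2
  have h2 := h.1
  by_contra! hD
  interval_cases D <;> omega

lemma distanceSet_repetitionCode (hq : 2 ≤ q) (hD : D ≠ 0) :
    distanceSet (repetitionCode D q) = {D} := by
  ext i
  simp only [mem_distanceSet, mem_repetitionCode, Set.mem_singleton_iff]
  constructor
  · rintro ⟨h0, _, ⟨a, rfl⟩, _, ⟨b, rfl⟩, rfl⟩
    have hab : a ≠ b := by rintro rfl; simp at h0
    simp [hammingDist, hab]
  · rintro rfl
    exact ⟨hD, _, ⟨⟨0, by omega⟩, rfl⟩, _, ⟨⟨1, by omega⟩, rfl⟩, by simp [hammingDist]⟩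

/-- The nontrivial character of the binary alphabet. -/
def binarySign (a : Fin 2) : ℂ := if a = 0 then 1 else -1

lemma sum_binarySign : ∑ a, binarySign a = 0 := by
  simp [binarySign]

lemma sum_repetitionCode_two (hD : D ≠ 0) (F : Vertex D 2 → ℂ) :
    ∑ y ∈ repetitionCode D 2, F y = F (fun _ => 0) + F fun _ => 1 := by
  have : Nonempty (Fin D) := ⟨⟨0, Nat.pos_of_ne_zero hD⟩⟩
  have hinj : Function.Injective fun (a : Fin 2) (_ : Fin D) => a := Function.const_injective
  rw [repetitionCode, Finset.sum_image hinj.injOn, Fin.sum_univ_two]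

lemma primIdem_one_repetitionCode (hD : D ≠ 0) :
    primIdem D 2 1 (charVec (repetitionCode D 2)) = 0 := by
  rw [primIdem_eq_zero_iff]
  intro w hw
  rw [inner_charVec, sum_repetitionCode_two hD]
  have h0 : ∀ y : Vertex D 2, ∏ i, (binarySign (y i) + 1) = if y = fun _ => 0 then 2 ^ D else 0 := by
    intro y
    split_ifs with h
    · subst h; norm_num [binarySign]
    · obtain ⟨i, hi⟩ := Function.ne_iff.1 h
      exact Finset.prod_eq_zero (mem_univ i) (by simp [binarySign, hi])
  have h1 : ∀ y : Vertex D 2, ∏ i, (-binarySign (y i) + 1) = if y = fun _ => 1 then 2 ^ D else 0 := by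
    intro y
    split_ifs with h
    · subst h; norm_num [binarySign]
    · obtain ⟨i, hi⟩ := Function.ne_iff.1 h
      have : y i = 0 := by omega
      exact Finset.prod_eq_zero (mem_univ i) (by simp [binarySign, this])
  have hT : ∀ T : Finset (Fin D), T.card ≠ 1 →
      ∑ y, coordProd T (fun _ => binarySign) y * w y = 0 := by
    intro T hT
    have := inner_eq_zero_of_mem_eigenspace two_ne_zero hT
      (coordProd_mem_eigenspace T (fun _ => binarySign) fun _ _ => sum_binarySign) hw
    have hconj : ∀ a, (starRingEnd ℂ) (binarySign a) = binarySign a := by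
      intro a; unfold binarySign; split_ifs <;> simp
    simpa [PiLp.inner_apply, coordProd, hconj, mul_comm] using this
  -- Fourier inversion at the two constant words: the characters of odd weight cancel, while `w` is
  -- orthogonal to all those of weight other than 1.
  have hsum : (2 : ℂ) ^ D * (w (fun _ => 0) + w fun _ => 1)
      = ∑ T : Finset (Fin D), (1 + (-1) ^ T.card) *
          ∑ y, coordProd T (fun _ => binarySign) y * w y := by
    calc (2 : ℂ) ^ D * (w (fun _ => 0) + w fun _ => 1)
        = ∑ y, (∏ i, (binarySign (y i) + 1) + ∏ i, (-binarySign (y i) + 1)) * w y := by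
          simp only [h0, h1, add_mul, ite_mul, zero_mul, Finset.sum_add_distrib,
            Finset.sum_ite_eq', mem_univ, if_true, mul_add]
      _ = _ := by
          simp_rw [Finset.mul_sum]
          rw [Finset.sum_comm]
          refine Finset.sum_congr rfl fun y _ => ?_
          rw [Finset.prod_add, Finset.prod_add, ← Finset.sum_add_distrib, Finset.sum_mul]
          refine Finset.sum_congr (by simp) fun T _ => ?_
          simp only [Finset.prod_neg, Finset.prod_const_one, coordProd]
          ring
  rw [Finset.sum_eq_zero] at hsum
  · simpa using hsum
  · intro T _
    by_cases hc : T.card = 1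
    · simp [hc]
    · rw [hT T hc, mul_zero]

lemma primIdem_two_repetitionCode (hD : 2 ≤ D) :
    primIdem D 2 2 (charVec (repetitionCode D 2)) ≠ 0 := by
  intro h
  obtain ⟨T, hT⟩ : ∃ T : Finset (Fin D), T.card = 2 := by
    obtain ⟨T, -, hT⟩ := Finset.exists_subset_card_eq (s := (univ : Finset (Fin D)))
      (n := 2) (by simpa using hD)
    exact ⟨T, hT⟩
  have hmem := coordProd_mem_eigenspace T (fun _ => binarySign) fun _ _ => sum_binarySign
  rw [hT] at hmem
  have := (primIdem_eq_zero_iff _ _).1 h _ hmem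
  rw [inner_charVec, sum_repetitionCode_two (by omega)] at this
  -- A character of weight 2 takes the value 1 at both constant words, so its sum over the code is
  -- 2.
  norm_num [coordProd, binarySign, hT] at this

lemma dualDistance_repetitionCode (hD : 2 ≤ D) : dualDistance (repetitionCode D 2) = 2 := by
  have h2 : 2 ∈ dualDistanceSet (repetitionCode D 2) :=
    ⟨two_ne_zero, hD, primIdem_two_repetitionCode hD⟩
  refine le_antisymm (Nat.sInf_le h2) ?_
  obtain ⟨h0, -, hne⟩ := Nat.sInf_mem ⟨2, h2⟩
  have h1 : sInf (dualDistanceSet (repetitionCode D 2)) ≠ 1 := fun h => by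
    rw [h] at hne
    exact hne (primIdem_one_repetitionCode (by omega))
  unfold dualDistance
  omega

end HammingScheme

theorem mainTheorem9 (D q : ℕ) (hq : 2 ≤ q) :
    (∀ Y : Finset (HammingScheme.Vertex D q), HammingScheme.IsCode Y →
      ¬ HammingScheme.IsBipartiteHalf Y →
        (HammingScheme.dualDistance Y : ℤ) ≤
          (HammingScheme.minDistance Y : ℤ) + (HammingScheme.degree Y : ℤ) - 1) ∧
    (q = 2 → HammingScheme.IsCode (HammingScheme.repetitionCode D q) →
      HammingScheme.dualDistance (HammingScheme.repetitionCode D q) = 2 ∧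
      HammingScheme.degree (HammingScheme.repetitionCode D q) = 1 ∧
      HammingScheme.minDistance (HammingScheme.repetitionCode D q) = D) := by
  refine ⟨fun Y hY hbip => ?_, ?_⟩
  · have := HammingScheme.dualDistance_lt hq hY hbip
    omega
  · rintro rfl hY
    have hD := HammingScheme.two_le_of_isCode_repetitionCode hY
    have hdist := HammingScheme.distanceSet_repetitionCode (D := D) hq (by omega)
    exact ⟨HammingScheme.dualDistance_repetitionCode hD,
      by rw [HammingScheme.degree, hdist, Set.ncard_singleton],
      by rw [HammingScheme.minDistance, hdist, csInf_singleton]⟩
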